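/- Theorem 5.1 (Pointwise ergodic theorem for groups with volume doubling, asymptotically invariant balls). Let $G$ be a locally compact second countable Hausdorff group with left Haar measure $m_G$. Let $d$ be a left-invariant metric on $G$ (not assumed to induce the topology of $G$, so that word metrics are included) whose closed balls $B_t=\{g\in G: d(g,e)\le t\}$ are Borel sets. Put $h_d=\limsup_{t\to\infty}\frac1t\log m_G(B_t)$ and $q_d=\limsup_{t\to\infty}\frac{\log m_G(B_t)}{\log t}$; for a compact symmetric set $V=V^{-1}$ with $\bigcup_{n}V^n=G$ put $h_V=\limsup_{n\to\infty}\frac1n\log m_G(V^n)$ and $q_V=\limsup_{n\to\infty}\frac{\log m_G(V^n)}{\log n}$. Assume that 1. $d$ is admissible: for every such $V$, $h_d>0$ if and only if $h_V>0$, and $q_d<\infty$ if and only if $q_V<\infty$; 2. $G$ has polynomial volume growth with respect to $d$: $q_d<\infty$; 3. (Calderón's doubling condition) there is a constant $C<\infty$ with $m_G(B_{2t})\le C\,m_G(B_t)$ for all $t>0$ with $m_G(B_t)>0$; 4. (asymptotic invariance) $\displaystyle\lim_{t\to\infty}\frac{m_G\big((B_tg)\,\triangle\,B_t\big)}{m_G(B_t)}=0$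 for every $g\in G$. Let $\beta_t$ be the measure on $G$ with density $\chi_{B_t}/m_G(B_t)$ with respect to $m_G$ (a probability measure when $m_G(B_t)>0$, which holds for all large $t$; when $m_G(B_t)=0$ it is read as the zero measure). Then the family $\beta_t$ satisfies the pointwise ergodic theorem in $L^p$ for every $1\le p<\infty$. That is, for every measurable, measure-preserving and ergodic action of $G$ on a standard Borel probability space $(X,m)$ and every $f\in L^p(X,m)$, the averages $$\pi(\beta_t)f(x)=\int_G f(g^{-1}x)\,d\beta_t(g)$$ are well defined (for almost every $x$ the integral converges absolutely for all $t$, and $\pi(\beta_t)f\in L^p(X,m)$), and, as $t\to\infty$ through the reals, $$\pi(\beta_t)f(x)\to\int_X f\,dm\quad\text{for } m\text{-almost every } x\in X,\qquad \Big\|\pi(\beta_t)f-\int_X f\,dm\Big\|_{L^p(X,m)}\to 0 .$$ -/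

import Mathlib

open MeasureTheory Filter Topology
open scoped ENNReal NNReal Pointwise

universe u v

noncomputable section

namespace BallAverages

/-- `d` is a left-invariant metric on the group `G`. Nothing relates `d` to a topology of `G`: word
metrics, whose topology is discrete, are allowed. -/
structure IsLeftInvariantMetric {G : Type*} [Group G] (d : G → G → ℝ) : Prop where
  eq_zero_iff : ∀ x y, d x y = 0 ↔ x = y
  symm : ∀ x y, d x y = d y x
  triangle : ∀ x y z, d x z ≤ d x y + d y z
  left_invariant : ∀ g x y, d (g * x) (g * y) = d x y

/-- The closed ball `B_t` of radius `t` centred at the identity. -/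
def ball {G : Type*} [Group G] (d : G → G → ℝ) (t : ℝ) : Set G := {g | d g 1 ≤ t}

/-- The exponential growth rate `h_d = lim (1/t) log m(B_t)` of the balls of `d`, taken as an upper
limit in `[-∞, ∞]` so that it exists for every `d`. -/
def expRate {G : Type*} [Group G] [MeasurableSpace G] (mG : Measure G) (d : G → G → ℝ) : EReal :=
  limsup (fun t : ℝ => ENNReal.log (mG (ball d t)) / (t : EReal)) atTop

/-- The polynomial growth degree `q_d = limsup log m(B_t) / log t` of the balls of `d`. -/
def polyRate {G : Type*} [Group G] [MeasurableSpace G] (mG : Measure G) (d : G → G → ℝ) : EReal :=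
  limsup (fun t : ℝ => ENNReal.log (mG (ball d t)) / ((Real.log t : ℝ) : EReal)) atTop

/-- `V` is a compact symmetric set that generates `G`. -/
structure IsCompactGenerating {G : Type*} [Group G] [TopologicalSpace G] (V : Set G) : Prop where
  isCompact : IsCompact V
  symmetric : V⁻¹ = V
  generates : ⋃ n : ℕ, V ^ n = Set.univ

/-- The exponential growth rate `h_V = lim (1/n) log m(V^n)` of a compact generating set. -/
def wordExpRate {G : Type*} [Group G] [MeasurableSpace G] (mG : Measure G) (V : Set G) : EReal :=
  limsup (fun n : ℕ => ENNReal.log (mG (V ^ n)) / ((n : ℝ) : EReal)) atTop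

/-- The polynomial growth degree `q_V = limsup log m(V^n) / log n` of a compact generating set. -/
def wordPolyRate {G : Type*} [Group G] [MeasurableSpace G] (mG : Measure G) (V : Set G) : EReal :=
  limsup (fun n : ℕ => ENNReal.log (mG (V ^ n)) / ((Real.log n : ℝ) : EReal)) atTop

/-- `d` is an admissible metric: it is a left-invariant metric, its balls centred at the identity
are Borel sets (which has to hold for the ball averages to make sense), and its growth rates have
the same type as those of the compact symmetric generating sets of `G`. -/
structure IsAdmissibleMetric {G : Type*} [Group G] [TopologicalSpace G] [MeasurableSpace G]
    (mG : Measure G) (d : G → G → ℝ) : Prop where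
  isMetric : IsLeftInvariantMetric d
  measurableSet_ball : ∀ t, MeasurableSet (ball d t)
  expRate_iff : ∀ V : Set G, IsCompactGenerating V → (0 < expRate mG d ↔ 0 < wordExpRate mG V)
  polyRate_iff : ∀ V : Set G, IsCompactGenerating V → (polyRate mG d < ⊤ ↔ wordPolyRate mG V < ⊤)

/-- `G` has polynomial volume growth with respect to `d`. -/
def HasPolynomialGrowth {G : Type*} [Group G] [MeasurableSpace G] (mG : Measure G)
    (d : G → G → ℝ) : Prop :=
  polyRate mG d < ⊤

/-- Calderon's doubling condition `m(B_{2t}) ≤ C m(B_t)`. It is required at all radii `t > 0` at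
which the ball average is defined, that is, at which `m(B_t) > 0`. When the metric induces the
topology these are all `t > 0`; for a word metric on a non-discrete group the balls of radius
`t < 1` are null sets, and the condition is void there. -/
def HasVolumeDoubling {G : Type*} [Group G] [MeasurableSpace G] (mG : Measure G)
    (d : G → G → ℝ) : Prop :=
  ∃ C : ℝ≥0, ∀ t : ℝ, 0 < t → 0 < mG (ball d t) → mG (ball d (2 * t)) ≤ C * mG (ball d t)

/-- The balls are asymptotically invariant under right translations:
`m((B_t g) Δ B_t) / m(B_t) → 0` as `t → ∞`, for every `g`. -/
def AsymptoticallyInvariantBalls {G : Type*} [Group G] [MeasurableSpace G] (mG : Measure G)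
    (d : G → G → ℝ) : Prop :=
  ∀ g : G, Tendsto
    (fun t : ℝ => mG (symmDiff ((fun x => x * g) '' ball d t) (ball d t)) / mG (ball d t))
    atTop (𝓝 0)

/-- The normalized ball average `β_t`: the measure with density `χ_{B_t} / m(B_t)` with respect to
the Haar measure `mG`. -/
def ballAverage {G : Type*} [Group G] [MeasurableSpace G] (mG : Measure G)
    (d : G → G → ℝ) (t : ℝ) : Measure G :=
  (mG (ball d t))⁻¹ • mG.restrict (ball d t)

/-- The averaging operator `π(ν) f (x) = ∫ f(g⁻¹ x) dν(g)`. -/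
def averageAlong {G X : Type*} [Group G] [MeasurableSpace G] [MulAction G X] (ν : Measure G)
    (f : X → ℂ) (x : X) : ℂ :=
  ∫ g, f (g⁻¹ • x) ∂ν

/-- The family of measures `ν t` on `G` satisfies the pointwise ergodic theorem in `L^p`: for every
ergodic probability-preserving measurable action of `G` on a standard Borel space `(X, m)` and every
`f ∈ L^p(X, m)`, the averages `π(ν t) f` are well defined (the defining integrals converge for
almost every `x`, and they give functions in `L^p`), and they converge to `∫ f dm` as `t → ∞`, both
almost everywhere and in the `L^p` norm. -/
def SatisfiesPointwiseErgodicTheorem {G : Type u} [Group G] [MeasurableSpace G]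
    (ν : ℝ → Measure G) (p : ℝ≥0∞) : Prop :=
  ∀ (X : Type v) [MeasurableSpace X] [StandardBorelSpace X] [MulAction G X] [MeasurableSMul₂ G X]
    (m : Measure X) [IsProbabilityMeasure m] [ErgodicSMul G X m] (f : X → ℂ), MemLp f p m →
    (∀ᵐ x ∂m, ∀ t : ℝ, Integrable (fun g : G => f (g⁻¹ • x)) (ν t)) ∧
    (∀ t : ℝ, MemLp (averageAlong (ν t) f) p m) ∧
    (∀ᵐ x ∂m, Tendsto (fun t : ℝ => averageAlong (ν t) f x) atTop (𝓝 (∫ y, f y ∂m))) ∧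
    Tendsto (fun t : ℝ => eLpNorm (fun x => averageAlong (ν t) f x - ∫ y, f y ∂m) p m)
      atTop (𝓝 0)

end BallAverages

end

/-! The argument is the classical one: a maximal inequality together with convergence on a dense
set. Doubling makes the Vitali covering argument work on `G`, which bounds, with constant `C ^ 2`,
the measure of a set of centres of balls with large averages. Transference along orbits carries this
to `X` as a weak-type (1,1) inequality (`mul_measure_exists_ge_le`); doubling also bounds the loss
from enlarging the window `B_T` to `B_{2T}`. The dense set is spanned in `L²` by constants and
coboundaries, by the mean ergodic theorem. On bounded coboundaries the averages tend to zero at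
every point, by asymptotic invariance; this uses right invariance of Haar measure, itself a
consequence of asymptotic invariance. The Banach principle (`averageConverges_of_tendsto`) is
applied twice: to pass to all of `L²`, then from `L²` to `L¹`. Since `m` is a probability measure,
this covers every `L^p`. Norm convergence follows from dominated convergence for simple functions
and contractivity of the averages on `L^p`. -/

namespace BallAverages

/-! ### Volume of balls and the covering argument on the group -/

section Balls

variable {G : Type*} [Group G] {d : G → G → ℝ}

theorem ball_mono {s t : ℝ} (h : s ≤ t) : ball d s ⊆ ball d t := fun _ hg => le_trans hg h

theorem mem_smul_ball (hd : IsLeftInvariantMetric d) {g h : G} {r : ℝ} :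
    h ∈ g • ball d r ↔ d h g ≤ r := by
  rw [Set.mem_smul_set_iff_inv_smul_mem, smul_eq_mul]
  change d (g⁻¹ * h) 1 ≤ r ↔ _
  rw [← hd.left_invariant g, mul_inv_cancel_left, mul_one]

theorem iUnion_ball (d : G → G → ℝ) : ⋃ n : ℕ, ball d n = Set.univ :=
  Set.eq_univ_of_forall fun g => Set.mem_iUnion.2 (exists_nat_ge (d g 1))

variable [MeasurableSpace G] {mG : Measure G}

/-- If a ball had infinite measure, so would all larger ones, and the quotients in `polyRate` would
equal `⊤` at all large radii. Polynomial growth enters the proof only through this finiteness. -/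
theorem HasPolynomialGrowth.measure_ball_ne_top (h : HasPolynomialGrowth mG d) (t : ℝ) :
    mG (ball d t) ≠ ∞ := by
  have h1 := eventually_lt_of_limsup_lt (show limsup (fun t : ℝ =>
    ENNReal.log (mG (ball d t)) / ((Real.log t : ℝ) : EReal)) atTop < ⊤ from h)
  obtain ⟨s, hs, hst, hs1⟩ :=
    (h1.and ((eventually_ge_atTop t).and (eventually_gt_atTop (1 : ℝ)))).exists
  refine ne_top_of_le_ne_top ?_ (measure_mono (ball_mono hst))
  intro htop
  rw [htop, ENNReal.log_top, EReal.top_div_of_pos_ne_top] at hs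
  · exact lt_irrefl _ hs
  · exact_mod_cast Real.log_pos hs1
  · exact EReal.coe_ne_top _

theorem exists_measure_ball_pos [NeZero mG] (d : G → G → ℝ) :
    ∃ r : ℝ, 0 < r ∧ 0 < mG (ball d r) := by
  have h : mG (⋃ n : ℕ, ball d n) ≠ 0 := by
    rw [iUnion_ball]; exact NeZero.ne _
  rw [Ne, measure_iUnion_null_iff, not_forall] at h
  obtain ⟨n, hn⟩ := h
  refine ⟨n + 1, by positivity, (pos_iff_ne_zero.2 hn).trans_le (measure_mono (ball_mono ?_))⟩
  linarith

theorem ballAverage_of_null {t : ℝ} (h : mG (ball d t) = 0) : ballAverage mG d t = 0 := by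
  rw [ballAverage, Measure.restrict_eq_zero.2 h, smul_zero]

theorem isProbabilityMeasure_ballAverage {t : ℝ} (h : mG (ball d t) ≠ 0)
    (h' : mG (ball d t) ≠ ∞) : IsProbabilityMeasure (ballAverage mG d t) :=
  ⟨by rw [ballAverage, Measure.smul_apply, Measure.restrict_apply_univ, smul_eq_mul,
    ENNReal.inv_mul_cancel h h']⟩

theorem ballAverage_univ_le (mG : Measure G) (d : G → G → ℝ) (t : ℝ) :
    ballAverage mG d t Set.univ ≤ 1 := by
  rw [ballAverage, Measure.smul_apply, Measure.restrict_apply_univ, smul_eq_mul]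
  exact ENNReal.inv_mul_le_one _

theorem ballAverage_absolutelyContinuous (mG : Measure G) (d : G → G → ℝ) (t : ℝ) :
    ballAverage mG d t ≪ mG :=
  (Measure.smul_absolutelyContinuous).trans Measure.restrict_le_self.absolutelyContinuous

theorem lintegral_ballAverage (mG : Measure G) (d : G → G → ℝ) (t : ℝ) (F : G → ℝ≥0∞) :
    ∫⁻ g, F g ∂ballAverage mG d t = (mG (ball d t))⁻¹ * ∫⁻ g in ball d t, F g ∂mG := by
  rw [ballAverage, lintegral_smul_measure, smul_eq_mul]

theorem measure_ball_four_mul_le {C : ℝ≥0}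
    (hC : ∀ t : ℝ, 0 < t → 0 < mG (ball d t) → mG (ball d (2 * t)) ≤ C * mG (ball d t))
    {r : ℝ} (hr : 0 < r) (hpos : 0 < mG (ball d r)) :
    mG (ball d (4 * r)) ≤ C ^ 2 * mG (ball d r) := by
  have h2 : mG (ball d r) ≤ mG (ball d (2 * r)) := measure_mono (ball_mono (by linarith))
  calc mG (ball d (4 * r)) = mG (ball d (2 * (2 * r))) := by ring_nf
    _ ≤ C * mG (ball d (2 * r)) := hC _ (by linarith) (hpos.trans_le h2)
    _ ≤ C * (C * mG (ball d r)) := by gcongr; exact hC _ hr hpos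
    _ = C ^ 2 * mG (ball d r) := by ring

/-- The Vitali covering argument: a set of centres of balls on which the averages of `F` exceed `a`
has measure controlled by the integral of `F`. -/
theorem mul_measure_le_of_lintegral_smul_ball [MeasurableMul G] [mG.IsMulLeftInvariant]
    (hd : IsLeftInvariantMetric d) (hball : ∀ t, MeasurableSet (ball d t))
    (hfin : ∀ t, mG (ball d t) ≠ ∞) {C : ℝ≥0}
    (hC : ∀ t : ℝ, 0 < t → 0 < mG (ball d t) → mG (ball d (2 * t)) ≤ C * mG (ball d t))
    {T : ℝ} {a : ℝ≥0∞} (F : G → ℝ≥0∞) {E : Set G} (hE : E ⊆ ball d T)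
    (h : ∀ g ∈ E, ∃ r, 0 < r ∧ r ≤ T ∧ 0 < mG (ball d r) ∧
      a * mG (ball d r) ≤ ∫⁻ u in g • ball d r, F u ∂mG) :
    a * mG E ≤ C ^ 2 * ∫⁻ u in ball d (2 * T), F u ∂mG := by
  classical
  choose! r hr0 hrT hrpos hr using h
  -- Each ball meets a selected one, centred at `b`, with `r g ≤ 2 * r b`. Hence `d g b ≤ 3 * r b`,
  -- and the fourfold balls cover the centres; the factor 4 costs two doublings, whence `C ^ 2`.
  obtain ⟨w, hwE, hdisj, hcov⟩ :=
    Vitali.exists_disjoint_subfamily_covering_enlargement (fun g => g • ball d (r g)) E r 2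
      one_lt_two (fun g hg => (hr0 g hg).le) T hrT fun g hg =>
        ⟨g, (mem_smul_ball hd).2 (by rw [(hd.eq_zero_iff g g).2 rfl]; exact (hr0 g hg).le)⟩
  have hmeas : ∀ g : G, ∀ t, MeasurableSet (g • ball d t) := fun g t => (hball t).const_smul g
  have hsub : ∀ g ∈ w, g • ball d (r g) ⊆ ball d (2 * T) := by
    intro g hg u hu
    have h1 := (mem_smul_ball hd).1 hu
    have h2 : d g 1 ≤ T := hE (hwE hg)
    have h3 := hd.triangle u g 1
    have h4 := hrT g (hwE hg)
    change d u 1 ≤ 2 * T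
    linarith
  -- Since `d` need not be separable, countability comes from measure: disjoint sets of positive
  -- measure inside `B_{2T}`, which has finite measure.
  have hcount : w.Countable := by
    have := Measure.countable_meas_pos_of_disjoint_of_meas_iUnion_ne_top mG
      (As := fun g : w => (g : G) • ball d (r g)) (fun g => hmeas _ _)
      (fun x y hxy => hdisj x.2 y.2 (fun hh => hxy (Subtype.ext hh)))
      (ne_top_of_le_ne_top (hfin (2 * T)) (measure_mono (Set.iUnion_subset fun g => hsub g g.2)))
    have huniv : {i : w | 0 < mG ((i : G) • ball d (r i))} = Set.univ := by
      refine Set.eq_univ_of_forall fun g => ?_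
      rw [Set.mem_ofPred_eq, measure_smul]
      exact hrpos g (hwE g.2)
    rw [huniv, Set.countable_univ_iff] at this
    exact Set.countable_coe_iff.1 this
  have hEsub : E ⊆ ⋃ g ∈ w, g • ball d (4 * r g) := by
    intro g hg
    obtain ⟨b, hb, ⟨z, hz1, hz2⟩, hle⟩ := hcov g hg
    refine Set.mem_biUnion hb ((mem_smul_ball hd).2 ?_)
    have h1 := (mem_smul_ball hd).1 hz1
    have h2 := (mem_smul_ball hd).1 hz2
    have h3 := hd.triangle g z b
    rw [hd.symm g z] at h3
    have := hr0 b (hwE hb)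
    linarith
  have := hcount.to_subtype
  calc a * mG E ≤ a * ∑' g : w, mG ((g : G) • ball d (4 * r g)) := by
        gcongr
        exact (measure_mono hEsub).trans (measure_biUnion_le mG hcount _)
    _ = ∑' g : w, a * mG (ball d (4 * r g)) := by
        simp_rw [measure_smul, ENNReal.tsum_mul_left]
    _ ≤ ∑' g : w, C ^ 2 * ∫⁻ u in (g : G) • ball d (r g), F u ∂mG := by
        refine ENNReal.tsum_le_tsum fun g => ?_
        have hg := hwE g.2
        calc a * mG (ball d (4 * r g)) ≤ a * (C ^ 2 * mG (ball d (r g))) := by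
              gcongr; exact measure_ball_four_mul_le hC (hr0 g hg) (hrpos g hg)
          _ = C ^ 2 * (a * mG (ball d (r g))) := by ring
          _ ≤ _ := by gcongr; exact hr g hg
    _ = C ^ 2 * ∫⁻ u in ⋃ g ∈ w, g • ball d (r g), F u ∂mG := by
        rw [ENNReal.tsum_mul_left, lintegral_biUnion hcount (fun g _ => hmeas g _) hdisj]
    _ ≤ _ := by
        gcongr
        exact Set.iUnion₂_subset hsub

end Balls

/-! ### Transference and the maximal inequality -/

section Maximal

/-- The averaging operator of the ball averages on functions with values in `[0, ∞]`. -/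
noncomputable def upperAverage {G X : Type*} [Group G] [MeasurableSpace G] [MulAction G X]
    (mG : Measure G) (d : G → G → ℝ) (t : ℝ) (F : X → ℝ≥0∞) (x : X) : ℝ≥0∞ :=
  ∫⁻ g, F (g⁻¹ • x) ∂ballAverage mG d t

variable {G : Type*} [Group G] [MeasurableSpace G] {mG : Measure G} {d : G → G → ℝ}
  {X : Type*} [MulAction G X]

instance [SFinite mG] (t : ℝ) : SFinite (ballAverage mG d t) := by
  unfold ballAverage; infer_instance

theorem upperAverage_le_mul_upperAverage {C : ℝ≥0} {s t : ℝ} (hst : s ≤ t) (F : X → ℝ≥0∞)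
    (hs : mG (ball d s) ≠ 0) (hfin : mG (ball d s) ≠ ∞)
    (h : mG (ball d t) ≤ C * mG (ball d s)) (x : X) :
    upperAverage mG d s F x ≤ C * upperAverage mG d t F x := by
  have hinv : (mG (ball d s))⁻¹ ≤ C * (mG (ball d t))⁻¹ := by
    have ht : mG (ball d t) ≠ 0 := fun h0 => hs (measure_mono_null (ball_mono hst) h0)
    have ht' : mG (ball d t) ≠ ∞ := ne_top_of_le_ne_top (by finiteness) h
    rw [← div_eq_mul_inv, ENNReal.le_div_iff_mul_le (.inl ht) (.inl ht'), mul_comm,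
      ← div_eq_mul_inv]
    exact ENNReal.div_le_of_le_mul h
  rw [upperAverage, upperAverage, lintegral_ballAverage, lintegral_ballAverage, ← mul_assoc]
  gcongr
  exact ball_mono hst

/-- Substituting `w = g * u` turns an average based at the orbit point `g⁻¹ • x` into one over a
ball centred at `g`, for a function on `G` determined by `x`. This is what lets the covering
argument act along orbits. -/
theorem setLIntegral_smul_ball [MeasurableMul G] [mG.IsMulLeftInvariant]
    (hball : ∀ t, MeasurableSet (ball d t)) (F : X → ℝ≥0∞) (g : G) (r : ℝ) (x : X) :
    ∫⁻ u in ball d r, F (u⁻¹ • g⁻¹ • x) ∂mG = ∫⁻ w in g • ball d r, F (w⁻¹ • x) ∂mG := by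
  rw [← lintegral_indicator (hball r), ← lintegral_indicator ((hball r).const_smul g),
    ← lintegral_mul_left_eq_self ((g • ball d r).indicator _) g]
  refine lintegral_congr fun u => ?_
  by_cases hu : u ∈ ball d r
  · have : g * u ∈ g • ball d r := Set.smul_mem_smul_set hu
    rw [Set.indicator_of_mem hu, Set.indicator_of_mem this, mul_inv_rev, mul_smul]
  · have : g * u ∉ g • ball d r := fun h => hu ((Set.smul_mem_smul_set_iff (a := g)).1 h)
    rw [Set.indicator_of_notMem hu, Set.indicator_of_notMem this]

variable [MeasurableInv G] [SFinite mG] [MeasurableSpace X] [MeasurableSMul₂ G X]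

theorem measurable_upperAverage {F : X → ℝ≥0∞} (hF : Measurable F) (t : ℝ) :
    Measurable (upperAverage mG d t F) := by
  have : Measurable fun q : X × G => F (q.2⁻¹ • q.1) := by fun_prop
  exact this.lintegral_prod_right'

variable (m : Measure X) [SFinite m] [SMulInvariantMeasure G X m]

theorem lintegral_lintegral_smul {F : X → ℝ≥0∞} (hF : Measurable F) (ν : Measure G) [SFinite ν] :
    ∫⁻ x, ∫⁻ g, F (g⁻¹ • x) ∂ν ∂m = ν Set.univ * ∫⁻ x, F x ∂m := by
  have : Measurable fun q : X × G => F (q.2⁻¹ • q.1) := by fun_prop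
  rw [lintegral_lintegral_swap this.aemeasurable]
  simp_rw [fun g : G => (measurePreserving_smul g⁻¹ m).lintegral_comp hF]
  rw [lintegral_const, mul_comm]

variable [MeasurableMul G] [mG.IsMulLeftInvariant]

/-- The transference principle: the weak-type estimate for finitely many radii. -/
theorem mul_measure_exists_mem_finset_le
    (hd : IsLeftInvariantMetric d) (hball : ∀ t, MeasurableSet (ball d t))
    (hfin : ∀ t, mG (ball d t) ≠ ∞) {C : ℝ≥0}
    (hC : ∀ t : ℝ, 0 < t → 0 < mG (ball d t) → mG (ball d (2 * t)) ≤ C * mG (ball d t))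
    (s : Finset ℝ) {T : ℝ}
    (hT : 0 < T) (hTpos : 0 < mG (ball d T))
    (hs : ∀ r ∈ s, 0 < r ∧ r ≤ T ∧ 0 < mG (ball d r)) (a : ℝ≥0∞) {F : X → ℝ≥0∞}
    (hF : Measurable F) :
    a * m {x | ∃ r ∈ s, a ≤ upperAverage mG d r F x} ≤ C ^ 3 * ∫⁻ x, F x ∂m := by
  set A : Set X := {x | ∃ r ∈ s, a ≤ upperAverage mG d r F x} with hA
  have hAm : MeasurableSet A := by
    have : A = ⋃ r ∈ s, {x | a ≤ upperAverage mG d r F x} := by ext; simp [hA]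
    rw [this]
    exact Finset.measurableSet_biUnion s fun r _ =>
      measurableSet_le measurable_const (measurable_upperAverage hF r)
  -- For fixed `x`, the covering estimate is applied to `u ↦ F (u⁻¹ • x)`, with centres those `g` in
  -- `B_T` for which `g⁻¹ • x` lies in `A`.
  have key : ∀ x, a * ∫⁻ g in ball d T, A.indicator 1 (g⁻¹ • x) ∂mG ≤
      C ^ 2 * ∫⁻ u in ball d (2 * T), F (u⁻¹ • x) ∂mG := by
    intro x
    have hAx : MeasurableSet {g : G | g⁻¹ • x ∈ A} := by
      have : Measurable fun g : G => g⁻¹ • x := by fun_prop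
      exact this hAm
    have h1 : ∫⁻ g in ball d T, A.indicator 1 (g⁻¹ • x) ∂mG =
        mG ({g | g⁻¹ • x ∈ A} ∩ ball d T) := by
      rw [← Measure.restrict_apply hAx, ← lintegral_indicator_one hAx]
      rfl
    rw [h1]
    refine mul_measure_le_of_lintegral_smul_ball hd hball hfin hC (fun u => F (u⁻¹ • x))
      Set.inter_subset_right ?_
    rintro g ⟨⟨r, hr, har⟩, -⟩
    obtain ⟨h0, hrT, hpos⟩ := hs r hr
    refine ⟨r, h0, hrT, hpos, ?_⟩
    rw [upperAverage, lintegral_ballAverage, setLIntegral_smul_ball hball, mul_comm,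
      ← div_eq_mul_inv] at har
    exact (ENNReal.le_div_iff_mul_le (.inl hpos.ne') (.inl (hfin r))).1 har
  have hmain : a * (mG (ball d T) * m A) ≤ C ^ 2 * (mG (ball d (2 * T)) * ∫⁻ x, F x ∂m) := by
    have h1 := lintegral_lintegral_smul m (measurable_one.indicator hAm : Measurable (A.indicator
      (1 : X → ℝ≥0∞))) (mG.restrict (ball d T))
    have h2 := lintegral_lintegral_smul m hF (mG.restrict (ball d (2 * T)))
    rw [Measure.restrict_apply_univ] at h1 h2
    rw [lintegral_indicator_one hAm] at h1
    have h3 : Measurable fun q : X × G => A.indicator (1 : X → ℝ≥0∞) (q.2⁻¹ • q.1) :=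
      (measurable_one.indicator hAm).comp (by fun_prop)
    have h4 : Measurable fun q : X × G => F (q.2⁻¹ • q.1) := by fun_prop
    rw [← h1, ← h2, ← lintegral_const_mul _ h3.lintegral_prod_right',
      ← lintegral_const_mul _ h4.lintegral_prod_right']
    exact lintegral_mono key
  -- Integrating over `x` leaves the factor `m(B_{2T}) / m(B_T)`; doubling bounds it by a third `C`,
  -- uniformly in `T`.
  have hfinal : mG (ball d T) * (a * m A) ≤ mG (ball d T) * (C ^ 3 * ∫⁻ x, F x ∂m) := by
    calc mG (ball d T) * (a * m A) = a * (mG (ball d T) * m A) := by ring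
      _ ≤ C ^ 2 * (mG (ball d (2 * T)) * ∫⁻ x, F x ∂m) := hmain
      _ ≤ C ^ 2 * ((C * mG (ball d T)) * ∫⁻ x, F x ∂m) := by gcongr; exact hC T hT hTpos
      _ = _ := by ring
  exact (ENNReal.mul_le_mul_iff_right hTpos.ne' (hfin T)).1 hfinal

/-- The weak-type `(1, 1)` maximal inequality for the ball averages. -/
theorem mul_measure_exists_ge_le
    (hd : IsLeftInvariantMetric d) (hball : ∀ t, MeasurableSet (ball d t))
    (hfin : ∀ t, mG (ball d t) ≠ ∞) {C : ℝ≥0}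
    (hC : ∀ t : ℝ, 0 < t → 0 < mG (ball d t) → mG (ball d (2 * t)) ≤ C * mG (ball d t))
    {r₀ : ℝ} (hr₀ : 0 < r₀) (hpos : 0 < mG (ball d r₀)) (a : ℝ≥0∞)
    {F : X → ℝ≥0∞} (hF : Measurable F) :
    a * m {x | ∃ t, r₀ ≤ t ∧ a ≤ upperAverage mG d t F x} ≤ C ^ 4 * ∫⁻ x, F x ∂m := by
  have hposr : ∀ t, r₀ ≤ t → 0 < mG (ball d t) := fun t ht =>
    hpos.trans_le (measure_mono (ball_mono ht))
  have hle : ∀ k : ℕ, r₀ ≤ 2 ^ k * r₀ := fun k =>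
    le_mul_of_one_le_left hr₀.le (one_le_pow₀ one_le_two)
  have hC0 : (C : ℝ≥0∞) ≠ 0 := by
    intro h0
    have h1 := hC r₀ hr₀ hpos
    rw [h0, zero_mul, nonpos_iff_eq_zero] at h1
    exact (hposr (2 * r₀) (by linarith)).ne' h1
  -- A radius `t` lies below the next dyadic radius `2 ^ (k + 1) * r₀`, whose average is smaller by
  -- a factor at most `C`. Lowering the threshold to `a / C` thus reduces all real radii to
  -- countably many, at the cost of a fourth `C`.
  set A : ℕ → Set X := fun K =>
    {x | ∃ r ∈ (Finset.range (K + 1)).image fun k : ℕ => 2 ^ k * r₀,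
      a / C ≤ upperAverage mG d r F x} with hA
  have hAmono : Monotone A := by
    rintro K L hKL x ⟨r, hr, hx⟩
    exact ⟨r, Finset.image_subset_image (Finset.range_mono (by lia)) hr, hx⟩
  have hAle : ∀ K, a / C * m (A K) ≤ C ^ 3 * ∫⁻ x, F x ∂m := by
    intro K
    refine mul_measure_exists_mem_finset_le m hd hball hfin hC _ (T := 2 ^ K * r₀)
      (by positivity) (hposr _ (hle K)) ?_ _ hF
    simp only [Finset.mem_image, Finset.mem_range, forall_exists_index, and_imp]
    rintro r k hk rfl
    refine ⟨by positivity, ?_, hposr _ (hle k)⟩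
    gcongr
    · exact one_le_two
    · lia
  have hsub : {x | ∃ t, r₀ ≤ t ∧ a ≤ upperAverage mG d t F x} ⊆ ⋃ K, A K := by
    rintro x ⟨t, ht, hx⟩
    obtain ⟨k, hk1, hk2⟩ := exists_nat_pow_near ((one_le_div hr₀).2 ht) one_lt_two
    rw [le_div_iff₀ hr₀] at hk1
    rw [div_lt_iff₀ hr₀] at hk2
    have ht2 : mG (ball d (2 ^ (k + 1) * r₀)) ≤ C * mG (ball d t) :=
      (measure_mono (ball_mono (by rw [pow_succ]; linarith))).trans
        (hC t (hr₀.trans_le ht) (hposr t ht))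
    refine Set.mem_iUnion.2 ⟨k + 1, 2 ^ (k + 1) * r₀,
      Finset.mem_image_of_mem _ (Finset.mem_range.2 (by lia)), ?_⟩
    exact ENNReal.div_le_of_le_mul' (hx.trans (upperAverage_le_mul_upperAverage hk2.le F
      (hposr t ht).ne' (hfin t) ht2 x))
  calc a * m {x | ∃ t, r₀ ≤ t ∧ a ≤ upperAverage mG d t F x}
      ≤ a * m (⋃ K, A K) := by gcongr
    _ = C * (a / C * ⨆ K, m (A K)) := by
        rw [hAmono.measure_iUnion, ← mul_assoc, ENNReal.mul_div_cancel hC0 ENNReal.coe_ne_top]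
    _ ≤ C * (C ^ 3 * ∫⁻ x, F x ∂m) := by
        rw [ENNReal.mul_iSup]
        gcongr
        exact iSup_le hAle
    _ = _ := by ring

end Maximal

/-! ### Unimodularity -/

section Unimodular

variable {G : Type*} [Group G] [TopologicalSpace G] [IsTopologicalGroup G]
    [LocallyCompactSpace G] [SecondCountableTopology G] [MeasurableSpace G] [BorelSpace G]
    {mG : Measure G} [mG.IsHaarMeasure] {d : G → G → ℝ}

/-- A group with asymptotically invariant balls is unimodular. -/
theorem AsymptoticallyInvariantBalls.isMulRightInvariant (hinv : AsymptoticallyInvariantBalls mG d)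
    (hgrowth : HasPolynomialGrowth mG d) : mG.IsMulRightInvariant := by
  refine ⟨fun g => ?_⟩
  obtain ⟨c, hc⟩ : ∃ c : ℝ≥0, mG.map (· * g) = c • mG :=
    ⟨_, Measure.isMulLeftInvariant_eq_smul _ mG⟩
  suffices h : c = 1 by rw [hc, h, one_smul]
  obtain ⟨r, hr, hpos⟩ := exists_measure_ball_pos (mG := mG) d
  have himage : ∀ t : ℝ, mG ((fun x => x * g⁻¹) '' ball d t) = c * mG (ball d t) := by
    intro t
    have h1 := congrArg (fun μ : Measure G => μ (ball d t)) hc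
    rw [Measure.smul_apply, show (fun x => x * g) = MeasurableEquiv.mulRight g from rfl,
      (MeasurableEquiv.mulRight g).measurableEmbedding.map_apply] at h1
    rw [Set.image_mul_right, inv_inv]
    exact h1
  -- Right translation scales volume by `c`, so the symmetric difference has measure at least `|c -
  -- 1| * m(B_t)`. With truncated subtraction, `|c - 1|` is the maximum of the two differences.
  have hle : ∀ t, r ≤ t →
      max ((c : ℝ≥0∞) - 1) (1 - c) ≤ mG (symmDiff ((fun x => x * g⁻¹) '' ball d t) (ball d t)) /
        mG (ball d t) := by
    intro t ht
    have h0 : mG (ball d t) ≠ 0 := (hpos.trans_le (measure_mono (ball_mono ht))).ne'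
    have hT := hgrowth.measure_ball_ne_top t
    rw [ENNReal.le_div_iff_mul_le (.inl h0) (.inl hT), max_mul_of_nonneg _ _ zero_le]
    refine max_le ?_ ?_
    · rw [ENNReal.sub_mul fun _ _ => hT, one_mul, ← himage, Set.symmDiff_def]
      exact le_measure_sdiff.trans (measure_mono Set.subset_union_left)
    · rw [ENNReal.sub_mul fun _ _ => hT, one_mul, ← himage, Set.symmDiff_def]
      exact le_measure_sdiff.trans (measure_mono Set.subset_union_right)
  have h0 : max ((c : ℝ≥0∞) - 1) (1 - c) ≤ 0 :=
    ge_of_tendsto (hinv g⁻¹) (eventually_ge_atTop r |>.mono hle)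
  rw [max_le_iff, nonpos_iff_eq_zero, nonpos_iff_eq_zero, tsub_eq_zero_iff_le,
    tsub_eq_zero_iff_le] at h0
  exact_mod_cast le_antisymm h0.1 h0.2

end Unimodular

/-! ### Averages of coboundaries -/

section Coboundary

variable {G : Type*} [Group G] [MeasurableSpace G] {mG : Measure G} {d : G → G → ℝ}

theorem norm_setIntegral_sub_setIntegral_le {G : Type*} [MeasurableSpace G] {mG : Measure G}
    {φ : G → ℂ} (hφ : StronglyMeasurable φ) {M : ℝ}
    (hM : ∀ g, ‖φ g‖ ≤ M) {A B : Set G} (hA : MeasurableSet A) (hB : MeasurableSet B)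
    (hAfin : mG A ≠ ∞) (hBfin : mG B ≠ ∞) :
    ‖∫ g in A, φ g ∂mG - ∫ g in B, φ g ∂mG‖ ≤ M * mG.real (symmDiff A B) := by
  have hint : ∀ {S : Set G}, mG S ≠ ∞ → IntegrableOn φ S mG := fun {S} hS =>
    Measure.integrableOn_of_bounded hS hφ.aestronglyMeasurable (ae_of_all _ hM)
  have hAB : mG (symmDiff A B) ≠ ∞ :=
    ne_top_of_le_ne_top (by finiteness) ((measure_mono Set.symmDiff_subset_union).trans
      (measure_union_le A B))
  rw [← integral_indicator hA, ← integral_indicator hB,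
    ← integral_sub ((hint hAfin).integrable_indicator hA) ((hint hBfin).integrable_indicator hB)]
  have hconst : Integrable ((symmDiff A B).indicator fun _ => M) mG :=
    (integrableOn_const hAB).integrable_indicator (hA.symmDiff hB)
  refine (norm_integral_le_of_norm_le hconst (ae_of_all _ fun g => ?_)).trans_eq ?_
  · by_cases h1 : g ∈ A <;> by_cases h2 : g ∈ B <;>
      simp [h1, h2, Set.mem_symmDiff, hM g]
  · rw [integral_indicator (hA.symmDiff hB), setIntegral_const, smul_eq_mul, mul_comm]

theorem averageAlong_ballAverage {X : Type*} [MulAction G X] (mG : Measure G) (d : G → G → ℝ)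
    (t : ℝ) (f : X → ℂ) (x : X) :
    averageAlong (ballAverage mG d t) f x =
      ((mG (ball d t))⁻¹).toReal • ∫ g in ball d t, f (g⁻¹ • x) ∂mG := by
  rw [averageAlong, ballAverage, integral_smul_measure]

variable {X : Type*} [MeasurableSpace X] [MulAction G X] [MeasurableSMul₂ G X] [MeasurableInv G]
  [MeasurableMul G]

/-- The averages of a bounded coboundary tend to zero everywhere. -/
theorem tendsto_averageAlong_coboundary [mG.IsMulRightInvariant]
    (hball : ∀ t, MeasurableSet (ball d t)) (hfin : ∀ t, mG (ball d t) ≠ ∞)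
    (hinv : AsymptoticallyInvariantBalls mG d) {h : X → ℂ} (hh : StronglyMeasurable h) {M : ℝ}
    (hM : ∀ x, ‖h x‖ ≤ M) (g₀ : G) (x : X) :
    Tendsto (fun t => averageAlong (ballAverage mG d t) (fun y => h (g₀⁻¹ • y) - h y) x) atTop
      (𝓝 0) := by
  set φ : G → ℂ := fun g => h (g⁻¹ • x) with hφdef
  have hφ : StronglyMeasurable φ := hh.comp_measurable (by fun_prop)
  have hemb : MeasurableEmbedding fun g : G => g * g₀ :=
    (MeasurableEquiv.mulRight g₀).measurableEmbedding
  have hφM : ∀ g, ‖φ g‖ ≤ M := fun g => hM _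
  have hbound : ∀ t, ‖averageAlong (ballAverage mG d t) (fun y => h (g₀⁻¹ • y) - h y) x‖ ≤
      M * (mG (symmDiff ((fun x => x * g₀) '' ball d t) (ball d t)) / mG (ball d t)).toReal := by
    intro t
    have himg : mG ((fun x => x * g₀) '' ball d t) ≠ ∞ := by
      rw [Set.image_mul_right, measure_preimage_mul_right]
      exact hfin t
    -- As `g₀⁻¹ * g⁻¹ = (g * g₀)⁻¹`, the translate of `h` is absorbed into a right translate of the
    -- ball; only the symmetric difference then contributes.
    have h1 : ∫ g in ball d t, h (g₀⁻¹ • g⁻¹ • x) ∂mG =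
        ∫ g in (fun x => x * g₀) '' ball d t, φ g ∂mG := by
      rw [(measurePreserving_mul_right mG g₀).setIntegral_image_emb hemb]
      simp only [hφdef, mul_inv_rev, mul_smul]
    have hint : ∀ {ψ : G → ℂ}, StronglyMeasurable ψ → (∀ g, ‖ψ g‖ ≤ M) →
        IntegrableOn ψ (ball d t) mG := fun {ψ} hψ hψM =>
      Measure.integrableOn_of_bounded (hfin t) hψ.aestronglyMeasurable (ae_of_all _ hψM)
    rw [averageAlong_ballAverage, integral_sub
      (hint (ψ := fun g => h (g₀⁻¹ • g⁻¹ • x)) (hh.comp_measurable (by fun_prop)) fun g => hM _)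
      (hint hφ hφM), h1, norm_smul,
      Real.norm_of_nonneg ENNReal.toReal_nonneg, div_eq_mul_inv, ENNReal.toReal_mul, mul_comm,
      ← mul_assoc]
    gcongr
    exact norm_setIntegral_sub_setIntegral_le hφ hφM (hemb.measurableSet_image.2 (hball t))
      (hball t) himg (hfin t)
  refine squeeze_zero_norm hbound ?_
  have := ((ENNReal.tendsto_toReal ENNReal.zero_ne_top).comp (hinv g₀)).const_mul M
  simpa using this

end Coboundary

/-! ### The averaging operators on functions and on `L^p` -/

section Averages

variable {G : Type*} [Group G] [MeasurableSpace G] [MeasurableInv G]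
  {X : Type*} [MeasurableSpace X] [MulAction G X] [MeasurableSMul₂ G X]
  {m : Measure X} [SFinite m] [SMulInvariantMeasure G X m]

/-- By Tonelli, almost every orbit meets the exceptional null set in a `μ`-null set of `g`.
Domination by the single measure `μ` gives one null set of `x` good for all `i`, even for
uncountable `ι` such as the real radii. -/
theorem ae_forall_averageAlong_congr {ι : Type*} {μ : Measure G} [SFinite μ] {ν : ι → Measure G}
    (hν : ∀ i, ν i ≪ μ) {f f' : X → ℂ} (h : f =ᵐ[m] f') :
    ∀ᵐ x ∂m, ∀ i, (fun g : G => f (g⁻¹ • x)) =ᵐ[ν i] fun g : G => f' (g⁻¹ • x) := by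
  obtain ⟨N, hN, hNm, hN0⟩ := exists_measurable_superset_of_null (ae_iff.1 h)
  have h1 := lintegral_lintegral_smul m
    (measurable_one.indicator hNm : Measurable (N.indicator (1 : X → ℝ≥0∞))) μ
  have hmeas : Measurable fun q : X × G => N.indicator (1 : X → ℝ≥0∞) (q.2⁻¹ • q.1) :=
    (measurable_one.indicator hNm).comp (by fun_prop)
  rw [lintegral_indicator_one hNm, hN0, mul_zero,
    lintegral_eq_zero_iff hmeas.lintegral_prod_right'] at h1
  filter_upwards [h1] with x hx i
  have hmx : Measurable fun g : G => N.indicator (1 : X → ℝ≥0∞) (g⁻¹ • x) :=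
    hmeas.comp measurable_prodMk_left
  rw [Pi.zero_apply, lintegral_eq_zero_iff hmx] at hx
  refine hν i ?_
  filter_upwards [hx] with g hg
  by_contra hne
  have : g⁻¹ • x ∈ N := hN hne
  simp [this] at hg

theorem stronglyMeasurable_averageAlong (ν : Measure G) [SFinite ν] {f : X → ℂ}
    (hf : StronglyMeasurable f) : StronglyMeasurable (averageAlong ν f) := by
  have : StronglyMeasurable fun q : X × G => f (q.2⁻¹ • q.1) :=
    hf.comp_measurable (by fun_prop)
  exact this.integral_prod_right'

theorem averageAlong_ae_eq {ν : Measure G} [SFinite ν] {f f' : X → ℂ} (h : f =ᵐ[m] f') :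
    averageAlong ν f =ᵐ[m] averageAlong ν f' := by
  filter_upwards [ae_forall_averageAlong_congr
    (fun _ : Unit => Measure.AbsolutelyContinuous.refl ν) h] with x hx
  exact integral_congr_ae (hx ())

theorem aestronglyMeasurable_averageAlong (ν : Measure G) [SFinite ν] {f : X → ℂ}
    (hf : AEStronglyMeasurable f m) : AEStronglyMeasurable (averageAlong ν f) m :=
  ⟨averageAlong ν (hf.mk f), stronglyMeasurable_averageAlong ν hf.stronglyMeasurable_mk,
    averageAlong_ae_eq hf.ae_eq_mk⟩

/-- Averaging along a sub-probability measure is a contraction of `L^p`. -/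
theorem eLpNorm_averageAlong_le {ν : Measure G} (hν : ν Set.univ ≤ 1) {p : ℝ≥0∞} (hp : 1 ≤ p)
    (hp' : p ≠ ∞) {f : X → ℂ} (hf : AEStronglyMeasurable f m) :
    eLpNorm (averageAlong ν f) p m ≤ eLpNorm f p m := by
  have : IsFiniteMeasure ν := ⟨hν.trans_lt ENNReal.one_lt_top⟩
  rw [eLpNorm_congr_ae (averageAlong_ae_eq hf.ae_eq_mk), eLpNorm_congr_ae hf.ae_eq_mk]
  set f' := hf.mk f
  have hf' : StronglyMeasurable f' := hf.stronglyMeasurable_mk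
  have hp0 : p ≠ 0 := (zero_lt_one.trans_le hp).ne'
  have hppos : 0 < p.toReal := ENNReal.toReal_pos hp0 hp'
  rw [eLpNorm_eq_lintegral_rpow_enorm_toReal hp0 hp',
    eLpNorm_eq_lintegral_rpow_enorm_toReal hp0 hp']
  refine ENNReal.rpow_le_rpow ?_ (by positivity)
  calc ∫⁻ x, ‖averageAlong ν f' x‖ₑ ^ p.toReal ∂m
      ≤ ∫⁻ x, ∫⁻ g, ‖f' (g⁻¹ • x)‖ₑ ^ p.toReal ∂ν ∂m := by
        refine lintegral_mono fun x => ?_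
        have hmeas : AEStronglyMeasurable (fun g : G => f' (g⁻¹ • x)) ν :=
          (hf'.comp_measurable (by fun_prop)).aestronglyMeasurable
        have h1 : ‖averageAlong ν f' x‖ₑ ≤ eLpNorm (fun g : G => f' (g⁻¹ • x)) p ν := by
          -- Hölder on `ν` gives the extra factor `ν(G) ^ (1 - 1/p)`, which is at most 1 for a
          -- sub-probability measure.
          refine (enorm_integral_le_lintegral_enorm _).trans ?_
          rw [← eLpNorm_one_eq_lintegral_enorm]
          refine (eLpNorm_le_eLpNorm_mul_rpow_measure_univ hp hmeas).trans ?_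
          refine mul_le_of_le_one_right' (ENNReal.rpow_le_one hν ?_)
          have : (p.toReal)⁻¹ ≤ 1 :=
            inv_le_one_of_one_le₀ (by simpa using ENNReal.toReal_mono hp' hp)
          simpa using this
        calc ‖averageAlong ν f' x‖ₑ ^ p.toReal
            ≤ eLpNorm (fun g : G => f' (g⁻¹ • x)) p ν ^ p.toReal := by gcongr
          _ = _ := by
            rw [eLpNorm_eq_lintegral_rpow_enorm_toReal hp0 hp', ← ENNReal.rpow_mul,
              one_div_mul_cancel hppos.ne', ENNReal.rpow_one]
    _ = ν Set.univ * ∫⁻ x, ‖f' x‖ₑ ^ p.toReal ∂m :=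
        lintegral_lintegral_smul m (F := fun x => ‖f' x‖ₑ ^ p.toReal)
          (hf'.measurable.enorm.pow_const _) ν
    _ ≤ _ := mul_le_of_le_one_left' hν

theorem memLp_averageAlong {ν : Measure G} (hν : ν Set.univ ≤ 1) {p : ℝ≥0∞} (hp : 1 ≤ p)
    (hp' : p ≠ ∞) {f : X → ℂ} (hf : MemLp f p m) : MemLp (averageAlong ν f) p m := by
  have : IsFiniteMeasure ν := ⟨hν.trans_lt ENNReal.one_lt_top⟩
  exact ⟨aestronglyMeasurable_averageAlong ν hf.1,
    (eLpNorm_averageAlong_le hν hp hp' hf.1).trans_lt hf.2⟩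

variable {mG : Measure G} [SFinite mG] {d : G → G → ℝ}

/-- Integrability over the balls of integer radius is a countable family of almost everywhere
conditions, and it restricts to every smaller ball. -/
theorem ae_forall_integrable_ballAverage (hfin : ∀ t, mG (ball d t) ≠ ∞) {f : X → ℂ}
    (hf : Integrable f m) :
    ∀ᵐ x ∂m, ∀ t, Integrable (fun g : G => f (g⁻¹ • x)) (ballAverage mG d t) := by
  set f' := hf.1.mk f
  have hf' : StronglyMeasurable f' := hf.1.stronglyMeasurable_mk
  have hmeas : Measurable fun q : X × G => ‖f' (q.2⁻¹ • q.1)‖ₑ :=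
    hf'.measurable.enorm.comp (by fun_prop)
  have h1 : ∀ᵐ x ∂m, ∀ n : ℕ, ∫⁻ g in ball d n, ‖f' (g⁻¹ • x)‖ₑ ∂mG < ∞ := by
    refine ae_all_iff.2 fun n => ae_lt_top hmeas.lintegral_prod_right' ?_
    rw [lintegral_lintegral_smul m (F := fun x => ‖f' x‖ₑ) hf'.measurable.enorm,
      Measure.restrict_apply_univ]
    exact ENNReal.mul_ne_top (hfin n) (hf.congr hf.1.ae_eq_mk).2.ne
  filter_upwards [h1, ae_forall_averageAlong_congr (ballAverage_absolutelyContinuous mG d)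
    hf.1.ae_eq_mk] with x hx hcongr t
  refine Integrable.congr ?_ (hcongr t).symm
  by_cases h0 : mG (ball d t) = 0
  · rw [ballAverage_of_null h0]; exact integrable_zero_measure
  obtain ⟨n, hn⟩ := exists_nat_ge t
  have hint : IntegrableOn (fun g : G => f' (g⁻¹ • x)) (ball d n) mG :=
    ⟨(hf'.comp_measurable (by fun_prop)).aestronglyMeasurable, hx n⟩
  exact (hint.mono_set (ball_mono hn)).integrable.smul_measure (ENNReal.inv_ne_top.2 h0)

end Averages

/-! ### The mean ergodic theorem in `L²` -/

section MeanErgodic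

variable {G : Type*} [Group G] {X : Type*} [MeasurableSpace X] [MulAction G X] {m : Measure X}

/-- Preimages of Borel sets under `f` are invariant modulo null sets for each `g` separately, so
ergodicity makes them null or conull; countably many of them separate the values of `f`. -/
theorem ae_eq_const_of_forall_smul_ae_eq [ErgodicSMul G X m] {f : X → ℂ}
    (hf : AEStronglyMeasurable f m) (h : ∀ g : G, (fun x => f (g • x)) =ᵐ[m] f) :
    ∃ c, f =ᵐ[m] Function.const X c := by
  refine exists_eventuallyEq_const_of_forall_separating MeasurableSet fun U hU => ?_
  refine eventuallyConst_set.1 (aeconst_of_forall_preimage_smul_ae_eq G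
    (hf.aemeasurable.nullMeasurable hU : NullMeasurableSet (f ⁻¹' U) m) fun g => ?_)
  refine (h g).mono fun x hx => ?_
  change (f (g • x) ∈ U) = (f x ∈ U)
  exact congrArg (· ∈ U) hx

variable [MeasurableSpace G]

/-- The Koopman operator of a group element on `L²`. -/
noncomputable def koopman [MeasurableSMul G X] (m : Measure X) [SMulInvariantMeasure G X m]
    (g : G) : Lp ℂ 2 m →ₗᵢ[ℂ] Lp ℂ 2 m :=
  Lp.compMeasurePreservingₗᵢ ℂ (g • ·) (measurePreserving_smul g m)

theorem coeFn_koopman [MeasurableSMul G X] [SMulInvariantMeasure G X m] (g : G) (f : Lp ℂ 2 m) :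
    koopman m g f =ᵐ[m] fun x => f (g • x) :=
  Lp.coeFn_compMeasurePreserving f (measurePreserving_smul g m)

/-- The mean ergodic theorem: constants and coboundaries span a dense subspace of `L²`. -/
theorem eq_top_of_const_mem_of_coboundary_mem [MeasurableSMul G X] [IsProbabilityMeasure m]
    [ErgodicSMul G X m] (S : Submodule ℂ (Lp ℂ 2 m)) (hS : IsClosed (S : Set (Lp ℂ 2 m)))
    (hconst : Lp.const 2 m (1 : ℂ) ∈ S) (hcob : ∀ (g : G) (f : Lp ℂ 2 m), koopman m g f - f ∈ S) :
    S = ⊤ := by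
  have : CompleteSpace S := hS.completeSpace_coe
  rw [← S.orthogonal_eq_bot_iff, Submodule.eq_bot_iff]
  intro v hv
  rw [Submodule.mem_orthogonal] at hv
  have hinv : ∀ g : G, koopman m g v = v := by
    intro g
    have h1 := hv _ (hcob g v)
    have h2 : ‖koopman m g v‖ = ‖v‖ := (koopman m g).norm_map v
    -- Since `v` is orthogonal to its own coboundary, Pythagoras gives `‖Uv‖² = ‖Uv - v‖² + ‖v‖²`;
    -- as `U` is isometric, `Uv = v`.
    have h3 := norm_add_sq (𝕜 := ℂ) (koopman m g v - v) v
    rw [sub_add_cancel, h2, h1, map_zero, mul_zero, add_zero] at h3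
    have h4 : ‖koopman m g v - v‖ ^ 2 = 0 := by linarith
    exact sub_eq_zero.1 (norm_eq_zero.1 (pow_eq_zero_iff two_ne_zero |>.1 h4))
  obtain ⟨c, hc⟩ := ae_eq_const_of_forall_smul_ae_eq (G := G) (Lp.aestronglyMeasurable v)
    fun g => (coeFn_koopman g v).symm.trans (by rw [hinv g])
  have hvc : v = c • Lp.const 2 m (1 : ℂ) := by
    refine Lp.ext (hc.trans ?_)
    filter_upwards [Lp.coeFn_smul c (Lp.const 2 m (1 : ℂ))] with x h1
    simp [h1]
  have h5 : inner ℂ v v = 0 := by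
    nth_rw 1 [hvc]
    exact hv _ (S.smul_mem c hconst)
  exact inner_self_eq_zero.1 h5

end MeanErgodic

/-! ### Almost everywhere convergence and the Banach principle -/

section Convergence

variable {G : Type*} [Group G] [MeasurableSpace G] {X : Type*} [MeasurableSpace X] [MulAction G X]

/-- The ball averages of `f` converge almost everywhere to the mean of `f`. -/
def AverageConverges (mG : Measure G) (d : G → G → ℝ) (m : Measure X) (f : X → ℂ) : Prop :=
  ∀ᵐ x ∂m, Tendsto (fun t : ℝ => averageAlong (ballAverage mG d t) f x) atTop (𝓝 (∫ y, f y ∂m))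

variable {mG : Measure G} {d : G → G → ℝ} {m : Measure X}

theorem AverageConverges.const_smul {f : X → ℂ} (hf : AverageConverges mG d m f) (c : ℂ) :
    AverageConverges mG d m (c • f) := by
  filter_upwards [hf] with x hx
  simp only [Pi.smul_apply, integral_smul]
  exact (hx.const_smul c).congr fun t => (integral_smul c _).symm

theorem averageConverges_const [NeZero mG] [IsProbabilityMeasure m]
    (hfin : ∀ t, mG (ball d t) ≠ ∞) (c : ℂ) : AverageConverges mG d m fun _ => c := by
  obtain ⟨r, hr, hpos⟩ := exists_measure_ball_pos (mG := mG) d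
  refine ae_of_all _ fun x => tendsto_const_nhds.congr' ?_
  filter_upwards [eventually_ge_atTop r] with t ht
  have := isProbabilityMeasure_ballAverage
    (hpos.trans_le (measure_mono (ball_mono ht))).ne' (hfin t)
  simp [averageAlong]

variable [MeasurableInv G] [SFinite mG] [MeasurableSMul₂ G X] [SFinite m]
  [SMulInvariantMeasure G X m]

theorem AverageConverges.congr {f f' : X → ℂ} (hf : AverageConverges mG d m f)
    (h : f =ᵐ[m] f') : AverageConverges mG d m f' := by
  filter_upwards [hf, ae_forall_averageAlong_congr (ballAverage_absolutelyContinuous mG d) h]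
    with x hx hcongr
  rw [← integral_congr_ae h]
  refine hx.congr fun t => integral_congr_ae (hcongr t)

theorem AverageConverges.add (hfin : ∀ t, mG (ball d t) ≠ ∞) {f f' : X → ℂ}
    (hf : AverageConverges mG d m f) (hf' : AverageConverges mG d m f') (hi : Integrable f m)
    (hi' : Integrable f' m) : AverageConverges mG d m (f + f') := by
  filter_upwards [hf, hf', ae_forall_integrable_ballAverage hfin hi,
    ae_forall_integrable_ballAverage hfin hi'] with x h1 h2 h3 h4
  rw [integral_add' hi hi']
  exact (h1.add h2).congr fun t => (integral_add (h3 t) (h4 t)).symm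

/-- The Banach principle: almost everywhere convergence of the ball averages is preserved under
limits in `L¹`. -/
theorem averageConverges_of_tendsto [NeZero mG] [MeasurableMul G] [mG.IsMulLeftInvariant]
    (hd : IsLeftInvariantMetric d) (hball : ∀ t, MeasurableSet (ball d t))
    (hfin : ∀ t, mG (ball d t) ≠ ∞) {C : ℝ≥0}
    (hC : ∀ t : ℝ, 0 < t → 0 < mG (ball d t) → mG (ball d (2 * t)) ≤ C * mG (ball d t))
    {f : X → ℂ} {F : ℕ → X → ℂ} (hfm : Measurable f) (hFm : ∀ n, Measurable (F n))
    (hf : Integrable f m) (hF : ∀ n, Integrable (F n) m)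
    (hFconv : ∀ n, AverageConverges mG d m (F n))
    (hlim : Tendsto (fun n => ∫⁻ x, ‖f x - F n x‖ₑ ∂m) atTop (𝓝 0)) :
    AverageConverges mG d m f := by
  obtain ⟨r, hr, hpos⟩ := exists_measure_ball_pos (mG := mG) d
  have key : ∀ δ : ℝ, 0 < δ → ∀ᵐ x ∂m, ∀ᶠ t in atTop,
      ‖averageAlong (ballAverage mG d t) f x - ∫ y, f y ∂m‖ ≤ 3 * δ := by
    intro δ hδ
    have hδ' : ENNReal.ofReal δ ≠ 0 := (ENNReal.ofReal_pos.2 hδ).ne'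
    rw [ae_iff]
    set N := {x | ¬ ∀ᶠ t in atTop,
      ‖averageAlong (ballAverage mG d t) f x - ∫ y, f y ∂m‖ ≤ 3 * δ} with hN
    -- Three errors of size `δ` arise: averages of `f - F n`, convergence for `F n`, and the
    -- difference of the means. Only the first can fail on a set of positive measure, and the
    -- maximal inequality controls it. Letting `n` tend to infinity makes `N` null.
    have hle : ∀ᶠ n in atTop, ENNReal.ofReal δ * m N ≤ C ^ 4 * ∫⁻ x, ‖f x - F n x‖ₑ ∂m := by
      filter_upwards [(ENNReal.tendsto_nhds_zero.1 hlim) _ (ENNReal.ofReal_pos.2 hδ)] with n hn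
      refine le_trans ?_ (mul_measure_exists_ge_le m hd hball hfin hC hr hpos (ENNReal.ofReal δ)
        (F := fun x => ‖f x - F n x‖ₑ) (hfm.sub (hFm n)).enorm)
      gcongr ENNReal.ofReal δ * ?_
      refine measure_mono_ae (μ := m) (s := N) ?_
      filter_upwards [ae_forall_integrable_ballAverage hfin hf,
        ae_forall_integrable_ballAverage hfin (hF n), hFconv n] with x h1 h2 h3 hxN
      by_contra hx
      refine hxN ?_
      filter_upwards [eventually_ge_atTop r, (tendsto_iff_norm_sub_tendsto_zero.1 h3).eventually
        (eventually_le_nhds hδ)] with t ht htn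
      have h4 : upperAverage mG d t (fun x => ‖f x - F n x‖ₑ) x < ENNReal.ofReal δ := by
        by_contra hge
        exact hx ⟨t, ht, not_lt.1 hge⟩
      have h5 : ‖averageAlong (ballAverage mG d t) f x -
          averageAlong (ballAverage mG d t) (F n) x‖ ≤ δ := by
        rw [averageAlong, averageAlong, ← integral_sub (h1 t) (h2 t)]
        refine (ENNReal.ofReal_le_ofReal_iff hδ.le).1 ?_
        rw [ofReal_norm]
        exact (enorm_integral_le_lintegral_enorm _).trans h4.le
      have h6 : ‖∫ y, F n y ∂m - ∫ y, f y ∂m‖ ≤ δ := by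
        rw [norm_sub_rev, ← integral_sub hf (hF n)]
        refine (ENNReal.ofReal_le_ofReal_iff hδ.le).1 ?_
        rw [ofReal_norm]
        exact (enorm_integral_le_lintegral_enorm _).trans hn
      calc _ = ‖(averageAlong (ballAverage mG d t) f x -
            averageAlong (ballAverage mG d t) (F n) x) +
            (averageAlong (ballAverage mG d t) (F n) x - ∫ y, F n y ∂m) +
            (∫ y, F n y ∂m - ∫ y, f y ∂m)‖ := by congr 1; ring
        _ ≤ δ + δ + δ := (norm_add₃_le).trans (by gcongr)
        _ = 3 * δ := by ring
    have hzero : ENNReal.ofReal δ * m N ≤ 0 := by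
      refine ge_of_tendsto ?_ hle
      simpa using ENNReal.Tendsto.const_mul hlim (.inr (by finiteness : (C : ℝ≥0∞) ^ 4 ≠ ∞))
    simpa [hδ'] using hzero
  have hall : ∀ᵐ x ∂m, ∀ k : ℕ, ∀ᶠ t in atTop,
      ‖averageAlong (ballAverage mG d t) f x - ∫ y, f y ∂m‖ ≤ 3 * (1 / (k + 1 : ℝ)) :=
    ae_all_iff.2 fun k => key _ Nat.one_div_pos_of_nat
  filter_upwards [hall] with x hx
  rw [Metric.tendsto_nhds]
  intro ε hε
  obtain ⟨k, hk⟩ := exists_nat_one_div_lt (show 0 < ε / 3 by positivity)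
  filter_upwards [hx k] with t ht
  rw [dist_eq_norm]
  linarith

end Convergence

theorem integrable_Lp_two {X : Type*} [MeasurableSpace X] {m : Measure X} [IsFiniteMeasure m]
    (f : Lp ℂ 2 m) : Integrable f m :=
  (Lp.memLp f).integrable one_le_two

theorem lintegral_enorm_sub_le_edist {X : Type*} [MeasurableSpace X] {m : Measure X}
    [IsProbabilityMeasure m] (f g : Lp ℂ 2 m) :
    ∫⁻ x, ‖f x - g x‖ₑ ∂m ≤ edist f g := by
  rw [Lp.edist_def, ← eLpNorm_one_eq_lintegral_enorm]
  exact eLpNorm_le_eLpNorm_of_exponent_le one_le_two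
    ((Lp.aestronglyMeasurable f).sub (Lp.aestronglyMeasurable g))

/-! ### Convergence in norm and proof for all integrable functions -/

section Ergodic

variable {G : Type*} [Group G] [MeasurableSpace G] [MeasurableInv G]
  {mG : Measure G} [SFinite mG] {d : G → G → ℝ}
  {X : Type*} [MeasurableSpace X] [MulAction G X] [MeasurableSMul₂ G X]
  {m : Measure X} [IsProbabilityMeasure m]

/-- Convergence in `L^p` of the ball averages of a bounded function follows from almost everywhere
convergence. -/
theorem AverageConverges.tendsto_eLpNorm_of_bounded [SMulInvariantMeasure G X m] {f : X → ℂ}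
    (hconv : AverageConverges mG d m f) (hf : StronglyMeasurable f) {M : ℝ}
    (hM : ∀ x, ‖f x‖ ≤ M) {p : ℝ≥0∞} (hp : p ≠ 0) (hp' : p ≠ ∞) :
    Tendsto (fun t : ℝ => eLpNorm
      (fun x => averageAlong (ballAverage mG d t) f x - ∫ y, f y ∂m) p m) atTop (𝓝 0) := by
  have hppos : 0 < p.toReal := ENNReal.toReal_pos hp hp'
  simp_rw [eLpNorm_eq_lintegral_rpow_enorm_toReal hp hp']
  have hM0 : 0 ≤ M := by
    obtain ⟨x⟩ := nonempty_of_isProbabilityMeasure m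
    exact (norm_nonneg _).trans (hM x)
  have hbound : ∀ t x, ‖averageAlong (ballAverage mG d t) f x - ∫ y, f y ∂m‖ ≤ 2 * M := by
    intro t x
    have hν := ballAverage_univ_le mG d t
    have : IsFiniteMeasure (ballAverage mG d t) := ⟨hν.trans_lt ENNReal.one_lt_top⟩
    have h1 : ‖averageAlong (ballAverage mG d t) f x‖ ≤ M := by
      refine (norm_integral_le_of_norm_le_const (ae_of_all _ fun g => hM _)).trans ?_
      exact mul_le_of_le_one_right hM0 (ENNReal.toReal_mono ENNReal.one_ne_top hν)
    have h2 : ‖∫ y, f y ∂m‖ ≤ M := by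
      simpa using norm_integral_le_of_norm_le_const (μ := m) (ae_of_all _ hM)
    exact (norm_sub_le _ _).trans (by linarith)
  have hlim : Tendsto (fun t : ℝ => ∫⁻ x, ‖averageAlong (ballAverage mG d t) f x -
      ∫ y, f y ∂m‖ₑ ^ p.toReal ∂m) atTop (𝓝 (∫⁻ _, 0 ∂m)) := by
    refine tendsto_lintegral_filter_of_dominated_convergence
      (fun _ => ENNReal.ofReal (2 * M) ^ p.toReal) (Eventually.of_forall fun t => ?_)
      (Eventually.of_forall fun t => ae_of_all _ fun x => ?_) ?_ ?_
    · exact (((stronglyMeasurable_averageAlong _ hf).sub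
        stronglyMeasurable_const).measurable.enorm).pow_const _
    · gcongr
      rw [← ofReal_norm]
      exact ENNReal.ofReal_le_ofReal (hbound t x)
    · rw [lintegral_const, measure_univ, mul_one]
      finiteness
    · filter_upwards [hconv] with x hx
      have h1 : Tendsto (fun t => ‖averageAlong (ballAverage mG d t) f x - ∫ y, f y ∂m‖ₑ) atTop
          (𝓝 0) := by
        have := (hx.sub_const (∫ y, f y ∂m)).enorm
        simpa using this
      have := (ENNReal.continuous_rpow_const (y := p.toReal)).tendsto 0 |>.comp h1
      simpa [Function.comp_def, ENNReal.zero_rpow_of_pos hppos] using this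
  have := (ENNReal.continuous_rpow_const (y := 1 / p.toReal)).tendsto _ |>.comp hlim
  simpa [Function.comp_def, ENNReal.zero_rpow_of_pos (inv_pos.2 hppos)] using this

/-- If the averages of all simple functions converge almost everywhere, then those of all functions
in `L^p` converge in `L^p`. -/
theorem tendsto_eLpNorm_averageAlong [SMulInvariantMeasure G X m]
    (hfin : ∀ t, mG (ball d t) ≠ ∞)
    (hconv : ∀ s : SimpleFunc X ℂ, AverageConverges mG d m s) {p : ℝ≥0∞} (hp : 1 ≤ p)
    (hp' : p ≠ ∞) {f : X → ℂ} (hf : MemLp f p m) :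
    Tendsto (fun t : ℝ => eLpNorm
      (fun x => averageAlong (ballAverage mG d t) f x - ∫ y, f y ∂m) p m) atTop (𝓝 0) := by
  have hp0 : p ≠ 0 := (zero_lt_one.trans_le hp).ne'
  rw [ENNReal.tendsto_nhds_zero]
  intro ε hε
  have hε3 : ε / 3 ≠ 0 := (ENNReal.div_pos hε.ne' (by norm_num)).ne'
  obtain ⟨s, ⟨M, hM⟩, hsm, hsc, hs, hsp⟩ : ∃ s : X → ℂ, (∃ M, ∀ x, ‖s x‖ ≤ M) ∧
      StronglyMeasurable s ∧ AverageConverges mG d m s ∧ eLpNorm (f - s) p m < ε / 3 ∧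
      MemLp s p m := by
    obtain ⟨s, hs, hsp⟩ := hf.exists_simpleFunc_eLpNorm_sub_lt hp' hε3
    exact ⟨s, s.exists_forall_norm_le, s.stronglyMeasurable, hconv s, hs, hsp⟩
  have hfi : Integrable f m := hf.integrable hp
  have hsi : Integrable s m := hsp.integrable hp
  filter_upwards [(ENNReal.tendsto_nhds_zero.1 (hsc.tendsto_eLpNorm_of_bounded hsm hM
    hp0 hp')) _ (pos_iff_ne_zero.2 hε3)] with t ht
  set ν := ballAverage mG d t
  have hν : ν Set.univ ≤ 1 := ballAverage_univ_le mG d t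
  have hmeas : ∀ {h : X → ℂ}, AEStronglyMeasurable h m →
      AEStronglyMeasurable (averageAlong ν h) m := fun hh => aestronglyMeasurable_averageAlong ν hh
  -- The three terms are bounded by contractivity, by convergence for the bounded function `s`, and
  -- by comparing the `L¹` and `L^p` norms.
  have hdecomp : (fun x => averageAlong ν f x - ∫ y, f y ∂m) =ᵐ[m]
      (averageAlong ν (f - s) + fun x => averageAlong ν s x - ∫ y, s y ∂m) +
        fun _ => ∫ y, s y ∂m - ∫ y, f y ∂m := by
    filter_upwards [ae_forall_integrable_ballAverage hfin hfi,
      ae_forall_integrable_ballAverage hfin hsi] with x h1 h2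
    have : averageAlong ν (f - s) x = averageAlong ν f x - averageAlong ν s x :=
      integral_sub (h1 t) (h2 t)
    simp only [Pi.add_apply, this]
    ring
  have hmean : eLpNorm (fun _ : X => ∫ y, s y ∂m - ∫ y, f y ∂m) p m ≤ ε / 3 := by
    rw [eLpNorm_const _ hp0 (IsProbabilityMeasure.ne_zero m), measure_univ, ENNReal.one_rpow,
      mul_one, enorm_sub_rev, ← integral_sub hfi hsi]
    calc ‖∫ y, (f y - s y) ∂m‖ₑ ≤ ∫⁻ y, ‖(f - s) y‖ₑ ∂m := enorm_integral_le_lintegral_enorm _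
      _ = eLpNorm (f - s) 1 m := eLpNorm_one_eq_lintegral_enorm.symm
      _ ≤ eLpNorm (f - s) p m := eLpNorm_le_eLpNorm_of_exponent_le hp (hf.1.sub hsp.1)
      _ ≤ ε / 3 := hs.le
  rw [eLpNorm_congr_ae hdecomp]
  calc _ ≤ eLpNorm (averageAlong ν (f - s)) p m +
        eLpNorm (fun x => averageAlong ν s x - ∫ y, s y ∂m) p m +
        eLpNorm (fun _ : X => ∫ y, s y ∂m - ∫ y, f y ∂m) p m :=
        (eLpNorm_add_le ((hmeas (hf.1.sub hsp.1)).add ((hmeas hsp.1).sub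
          aestronglyMeasurable_const)) aestronglyMeasurable_const hp).trans (by
            gcongr
            exact eLpNorm_add_le (hmeas (hf.1.sub hsp.1)) ((hmeas hsp.1).sub
              aestronglyMeasurable_const) hp)
    _ ≤ ε / 3 + ε / 3 + ε / 3 := by
        gcongr
        exact (eLpNorm_averageAlong_le hν hp hp' (hf.1.sub hsp.1)).trans hs.le
    _ = ε := ENNReal.add_thirds ε

variable [MeasurableMul G]

/-- A simple function is bounded, so the pointwise coboundary estimate applies to its honest
representative. The limit 0 is the right one because invariance gives the coboundary mean zero. -/
theorem averageConverges_coboundary_simpleFunc [SMulInvariantMeasure G X m]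
    [mG.IsMulRightInvariant]
    (hball : ∀ t, MeasurableSet (ball d t)) (hfin : ∀ t, mG (ball d t) ≠ ∞)
    (hinv : AsymptoticallyInvariantBalls mG d) (g : G) (f : Lp.simpleFunc ℂ 2 m) :
    AverageConverges mG d m (koopman m g (f : Lp ℂ 2 m) - (f : Lp ℂ 2 m) : Lp ℂ 2 m) := by
  set h := Lp.simpleFunc.toSimpleFunc f
  have hf : (h : X → ℂ) =ᵐ[m] (f : Lp ℂ 2 m) := Lp.simpleFunc.toSimpleFunc_eq_toFun f
  obtain ⟨M, hM⟩ := h.exists_forall_norm_le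
  have hint : Integrable h m := (integrable_Lp_two (f : Lp ℂ 2 m)).congr hf.symm
  have h0 : ∫ x, (h (g • x) - h x) ∂m = 0 := by
    rw [integral_sub (f := fun x => h (g • x))
      ((measurePreserving_smul g m).integrable_comp_of_integrable hint) hint,
      sub_eq_zero]
    exact (measurePreserving_smul g m).integral_comp' (f := MeasurableEquiv.smul g) h
  have hconv : AverageConverges mG d m fun x => h (g • x) - h x := by
    refine ae_of_all _ fun x => ?_
    rw [h0]
    have := tendsto_averageAlong_coboundary hball hfin hinv h.stronglyMeasurable hM g⁻¹ x
    simpa only [inv_inv] using this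
  refine hconv.congr ?_
  filter_upwards [Lp.coeFn_sub (koopman m g (f : Lp ℂ 2 m)) (f : Lp ℂ 2 m),
    coeFn_koopman g (f : Lp ℂ 2 m), hf,
    (measurePreserving_smul g m).quasiMeasurePreserving.ae hf] with x h1 h2 h3 h4
  rw [h1, Pi.sub_apply, h2, h3, h4]

variable [NeZero mG]

/-- The functions in `L²` whose ball averages converge almost everywhere. -/
noncomputable def convergenceSubmodule [SMulInvariantMeasure G X m]
    (hfin : ∀ t, mG (ball d t) ≠ ∞) : Submodule ℂ (Lp ℂ 2 m) where
  carrier := {f | AverageConverges mG d m f}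
  zero_mem' := (averageConverges_const hfin 0).congr (Lp.coeFn_zero ℂ 2 m).symm
  add_mem' {f g} hf hg := (hf.add hfin hg (integrable_Lp_two f) (integrable_Lp_two g)).congr
    (Lp.coeFn_add f g).symm
  smul_mem' c f hf := (hf.const_smul c).congr (Lp.coeFn_smul c f).symm

/-- The ball averages of every integrable function converge almost everywhere. -/
theorem averageConverges_of_integrable [ErgodicSMul G X m] [mG.IsMulLeftInvariant]
    [mG.IsMulRightInvariant]
    (hd : IsLeftInvariantMetric d) (hball : ∀ t, MeasurableSet (ball d t))
    (hfin : ∀ t, mG (ball d t) ≠ ∞) (hdoubling : HasVolumeDoubling mG d)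
    (hinv : AsymptoticallyInvariantBalls mG d) {f : X → ℂ} (hf : Integrable f m) :
    AverageConverges mG d m f := by
  obtain ⟨C, hC⟩ := hdoubling
  -- Convergence in `L²` implies convergence in `L¹` on a probability space, so the Banach principle
  -- applies.
  have hclosed : IsClosed (convergenceSubmodule (m := m) hfin : Set (Lp ℂ 2 m)) := by
    refine IsSeqClosed.isClosed fun F f hF hlim => ?_
    refine averageConverges_of_tendsto hd hball hfin hC (Lp.stronglyMeasurable f).measurable
      (fun n => (Lp.stronglyMeasurable (F n)).measurable) (integrable_Lp_two f)
      (fun n => integrable_Lp_two (F n)) hF ?_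
    refine tendsto_of_tendsto_of_tendsto_of_le_of_le tendsto_const_nhds
      (tendsto_iff_edist_tendsto_0.1 hlim) (fun _ => zero_le) fun n => ?_
    rw [edist_comm]
    exact lintegral_enorm_sub_le_edist f (F n)
  have htop := eq_top_of_const_mem_of_coboundary_mem (G := G) _ hclosed
    ((averageConverges_const hfin 1).congr (Lp.coeFn_const 2 m (1 : ℂ)).symm) fun g f => by
      -- Unbounded coboundaries are reached from simple ones: `f ↦ koopman m g f - f` is continuous
      -- and the submodule is closed.
      refine DenseRange.induction_on
        (p := fun f : Lp ℂ 2 m => koopman m g f - f ∈ convergenceSubmodule hfin)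
        (Lp.simpleFunc.denseRange (p := 2) (by norm_num)) f
        (hclosed.preimage (by fun_prop)) fun s => ?_
      exact averageConverges_coboundary_simpleFunc hball hfin hinv g s
  have htwo : ∀ {h : X → ℂ}, MemLp h 2 m → AverageConverges mG d m h := fun {h} hh =>
    AverageConverges.congr (show hh.toLp h ∈ convergenceSubmodule hfin from htop ▸ trivial)
      hh.coeFn_toLp
  refine AverageConverges.congr ?_ hf.1.ae_eq_mk.symm
  have hf' : Integrable (hf.1.mk f) m := hf.congr hf.1.ae_eq_mk
  have hm : Measurable (hf.1.mk f) := hf.1.stronglyMeasurable_mk.measurable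
  -- The second use of the Banach principle: simple functions lie in `L²` and approximate `f` in
  -- `L¹`.
  refine averageConverges_of_tendsto hd hball hfin hC hm
    (fun n => SimpleFunc.measurable _) hf'
    (fun n => SimpleFunc.integrable_approxOn_range hm hf' n)
    (fun n => htwo (SimpleFunc.memLp_of_isFiniteMeasure _ 2 m)) ?_
  have := SimpleFunc.tendsto_approxOn_range_L1_enorm hm hf'
  simpa only [enorm_sub_rev] using this

end Ergodic

end BallAverages

theorem theorem5p1 {G : Type u} [Group G] [TopologicalSpace G] [IsTopologicalGroup G]
    [LocallyCompactSpace G] [SecondCountableTopology G] [T2Space G]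
    [MeasurableSpace G] [BorelSpace G]
    (mG : Measure G) [mG.IsHaarMeasure] (d : G → G → ℝ)
    (hd : BallAverages.IsAdmissibleMetric mG d)
    (hgrowth : BallAverages.HasPolynomialGrowth mG d)
    (hdoubling : BallAverages.HasVolumeDoubling mG d)
    (hinv : BallAverages.AsymptoticallyInvariantBalls mG d)
    (p : ℝ≥0∞) (hp : 1 ≤ p) (hp' : p < ∞) :
    BallAverages.SatisfiesPointwiseErgodicTheorem.{u, v} (BallAverages.ballAverage mG d) p := by
  intro X _ _ _ _ m _ _ f hf
  have hfin := hgrowth.measure_ball_ne_top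
  have := hinv.isMulRightInvariant hgrowth
  have hconv : ∀ {h : X → ℂ}, Integrable h m → BallAverages.AverageConverges mG d m h :=
    BallAverages.averageConverges_of_integrable hd.isMetric hd.measurableSet_ball hfin hdoubling
      hinv
  exact ⟨BallAverages.ae_forall_integrable_ballAverage hfin (hf.integrable hp),
    fun t => BallAverages.memLp_averageAlong (BallAverages.ballAverage_univ_le mG d t) hp hp'.ne hf,
    hconv (hf.integrable hp),
    BallAverages.tendsto_eLpNorm_averageAlong hfin
      (fun s => hconv (SimpleFunc.integrable_of_isFiniteMeasure s)) hp hp'.ne hf⟩
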